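/- Let $k$ be a field of characteristic zero. A ternary algebra over $k$ is a $k$-vector space $A$ with a trilinear product $(a,b,c)\mapsto (abc)$ (no identities are assumed). For a ternary algebra let $$w_5^{(3)}(a_1,\dots,a_5)=((a_1a_2a_3)a_4a_5)+(a_1(a_2a_3a_4)a_5)+(a_1a_2(a_3a_4a_5)).$$ Let $L(A)$ and $R(A)$ be the (non-unital) associative subalgebras of $\mathrm{End}_k(A)$ generated, respectively, by all left multiplications $l_{a,b}\colon x\mapsto (abx)$ and by all right multiplications $r_{a,b}\colon x\mapsto (xab)$. An associative algebra $S$ is nilpotent if $S^n=0$ for some $n\ge 1$; the least such $n$ is its index. 1. If $A$ satisfies the identity $w_5^{(3)}=0$, then $L(A)^4=0$ and $R(A)^4=0$. The bound $4$ is sharp in general: for every $k$ there is a ternary algebra $A$ satisfying $w_5^{(3)}=0$ for which $L(A)$ and $R(A)$ are both nilpotent of index exactly $4$. 2. For every $k$ there is a ternary algebra $A$ satisfying $w_5^{(3)}=0$ such that the multiplicative universal enveloping algebra $U(A)$ generated by left and right multiplications is not nilpotent. Here $U(A)$ is the non-unital subalgebra generated by the universal left and right multiplications in the universal unital associative algebra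 with generators $l_{a,b}, m_{a,b}, r_{a,b}$ ($a,b\in A$) whose modules are the bimodules over $A$ in the variety of ternary algebras defined by $w_5^{(3)}=0$. Moreover, for the same $A$, already the subalgebra of $\mathrm{End}_k(A)$ generated by all $l_{a,b}$ and $r_{a,b}$ (the image of $U(A)$) is not nilpotent. -/

import Mathlib

universe u v

namespace TernaryAlg

section Basic

variable {k : Type u} [Field k] {A : Type v} [AddCommGroup A] [Module k A]

/-- A ternary algebra over `k` is a `k`-vector space `A` together with a trilinear map `μ`,
`μ a b c` being the product `(a b c)`; no identity is imposed.  `w μ n a` is the sum of all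
monomials of degree `n` in `a 0, a 1, …, a (n - 1)`, in this order.  It is defined by
`w 1 (a) = a 0` and, for `n ≥ 3`, as the sum over `i' + j' + k' = n`, `i', j', k' ≥ 1`, of
`(w i' (a 0, …) w j' (a i', …) w k' (a (i' + j'), …))`, here `i' = i + 1`, `j' = j + 1`.
It is zero for even `n`, where there are no monomials. -/
def w (μ : A →ₗ[k] A →ₗ[k] A →ₗ[k] A) : ℕ → (ℕ → A) → A
  | 0, _ => 0
  | 1, a => a 0
  | 2, _ => 0
  | n + 3, a =>
      ∑ i : Fin (n + 1), ∑ j : Fin (n + 1 - i),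
        μ (w μ (i + 1) a)
          (w μ (j + 1) (fun t => a (i + 1 + t)))
          (w μ (n - i - j + 1) (fun t => a (i + 1 + (j + 1) + t)))
  termination_by n _ => n
  decreasing_by
    · have := i.isLt; omega
    · have := j.isLt; omega
    · omega

/-- The identity `w_n = 0` holds in the ternary algebra `(A, μ)`. -/
def SatisfiesW (μ : A →ₗ[k] A →ₗ[k] A →ₗ[k] A) (n : ℕ) : Prop :=
  ∀ a : ℕ → A, w μ n a = 0

/-- The operation `w_5` written out. -/
theorem w_five (μ : A →ₗ[k] A →ₗ[k] A →ₗ[k] A) (a : ℕ → A) :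
    w μ 5 a = μ (μ (a 0) (a 1) (a 2)) (a 3) (a 4) + μ (a 0) (μ (a 1) (a 2) (a 3)) (a 4)
      + μ (a 0) (a 1) (μ (a 2) (a 3) (a 4)) := by
  simp [w, Fin.sum_univ_succ]
  abel

/-- The left multiplication `x ↦ (a b x)`. -/
def leftMul (μ : A →ₗ[k] A →ₗ[k] A →ₗ[k] A) (a b : A) : Module.End k A := μ a b

/-- The right multiplication `x ↦ (x a b)`. -/
def rightMul (μ : A →ₗ[k] A →ₗ[k] A →ₗ[k] A) (a b : A) : Module.End k A where
  toFun x := μ x a b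
  map_add' x y := by simp
  map_smul' c x := by simp

/-- The (non-unital) associative algebra `L(A)` generated by all left multiplications. -/
def L (μ : A →ₗ[k] A →ₗ[k] A →ₗ[k] A) : NonUnitalSubalgebra k (Module.End k A) :=
  NonUnitalAlgebra.adjoin k {f | ∃ a b : A, f = leftMul μ a b}

/-- The (non-unital) associative algebra `R(A)` generated by all right multiplications. -/
def R (μ : A →ₗ[k] A →ₗ[k] A →ₗ[k] A) : NonUnitalSubalgebra k (Module.End k A) :=
  NonUnitalAlgebra.adjoin k {f | ∃ a b : A, f = rightMul μ a b}

/-- The (non-unital) associative algebra of endomorphisms of `A` generated by all left and all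
right multiplications. -/
def LR (μ : A →ₗ[k] A →ₗ[k] A →ₗ[k] A) : NonUnitalSubalgebra k (Module.End k A) :=
  NonUnitalAlgebra.adjoin k
    ({f | ∃ a b : A, f = leftMul μ a b} ∪ {f | ∃ a b : A, f = rightMul μ a b})

end Basic

/-- Symbols `l a b`, `m a b`, `r a b` for the three actions `x ↦ (a b x)`, `x ↦ (a x b)`,
`x ↦ (x a b)` of a ternary algebra `A` on a bimodule. -/
inductive MulSym (A : Type v) : Type v
  | l : A → A → MulSym A
  | m : A → A → MulSym A
  | r : A → A → MulSym A

section Envelope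

variable {k : Type u} [Field k] {A : Type v} [AddCommGroup A] [Module k A]

/-- A symbol as an element of the free associative unital algebra on all symbols. -/
abbrev gen (k : Type u) [Field k] {A : Type v} (s : MulSym A) : FreeAlgebra k (MulSym A) :=
  FreeAlgebra.ι k s

open MulSym in
/-- The relations of the universal multiplicative envelope for the variety of ternary algebras
with `w_5 = 0`: the symbols are bilinear, and `w_5` vanishes whenever one of its five arguments,
the `i`-th one in `w5_i`, is taken from a bimodule and the other four from `A`. -/
inductive Rel (μ : A →ₗ[k] A →ₗ[k] A →ₗ[k] A) :
    FreeAlgebra k (MulSym A) → FreeAlgebra k (MulSym A) → Prop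
  | l_add_left (a a' b : A) : Rel μ (gen k (l (a + a') b)) (gen k (l a b) + gen k (l a' b))
  | l_add_right (a b b' : A) : Rel μ (gen k (l a (b + b'))) (gen k (l a b) + gen k (l a b'))
  | l_smul_left (c : k) (a b : A) : Rel μ (gen k (l (c • a) b)) (c • gen k (l a b))
  | l_smul_right (c : k) (a b : A) : Rel μ (gen k (l a (c • b))) (c • gen k (l a b))
  | m_add_left (a a' b : A) : Rel μ (gen k (m (a + a') b)) (gen k (m a b) + gen k (m a' b))
  | m_add_right (a b b' : A) : Rel μ (gen k (m a (b + b'))) (gen k (m a b) + gen k (m a b'))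
  | m_smul_left (c : k) (a b : A) : Rel μ (gen k (m (c • a) b)) (c • gen k (m a b))
  | m_smul_right (c : k) (a b : A) : Rel μ (gen k (m a (c • b))) (c • gen k (m a b))
  | r_add_left (a a' b : A) : Rel μ (gen k (r (a + a') b)) (gen k (r a b) + gen k (r a' b))
  | r_add_right (a b b' : A) : Rel μ (gen k (r a (b + b'))) (gen k (r a b) + gen k (r a b'))
  | r_smul_left (c : k) (a b : A) : Rel μ (gen k (r (c • a) b)) (c • gen k (r a b))
  | r_smul_right (c : k) (a b : A) : Rel μ (gen k (r a (c • b))) (c • gen k (r a b))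
  | w5_1 (b c d e : A) : Rel μ
      (gen k (r d e) * gen k (r b c) + gen k (r (μ b c d) e) + gen k (r b (μ c d e))) 0
  | w5_2 (a c d e : A) : Rel μ
      (gen k (r d e) * gen k (m a c) + gen k (m a e) * gen k (r c d) + gen k (m a (μ c d e))) 0
  | w5_3 (a b d e : A) : Rel μ
      (gen k (r d e) * gen k (l a b) + gen k (m a e) * gen k (m b d)
        + gen k (l a b) * gen k (r d e)) 0
  | w5_4 (a b c e : A) : Rel μ
      (gen k (m (μ a b c) e) + gen k (m a e) * gen k (l b c) + gen k (l a b) * gen k (m c e)) 0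
  | w5_5 (a b c d : A) : Rel μ
      (gen k (l (μ a b c) d) + gen k (l a (μ b c d)) + gen k (l a b) * gen k (l c d)) 0

/-- The unital universal multiplicative envelope of `(A, μ)` in the variety of ternary algebras
with `w_5 = 0`: its modules are the `A`-bimodules of that variety. -/
abbrev Envelope (μ : A →ₗ[k] A →ₗ[k] A →ₗ[k] A) : Type (max u v) := RingQuot (Rel μ)

/-- The image of a symbol in the universal multiplicative envelope. -/
def Envelope.of (μ : A →ₗ[k] A →ₗ[k] A →ₗ[k] A) (s : MulSym A) : Envelope μ :=
  RingQuot.mkAlgHom k (Rel μ) (gen k s)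

/-- The (non-unital) associative algebra generated by the universal left and right
multiplications inside the universal multiplicative envelope. -/
def U (μ : A →ₗ[k] A →ₗ[k] A →ₗ[k] A) : NonUnitalSubalgebra k (Envelope μ) :=
  NonUnitalAlgebra.adjoin k
    ({f | ∃ a b : A, f = Envelope.of μ (MulSym.l a b)} ∪ {f | ∃ a b : A, f = Envelope.of μ (MulSym.r a b)})

end Envelope

section Nilpotence

variable {k : Type u} [Field k] {B : Type v} [Ring B] [Algebra k B]

/-- `S ^ n = 0`: all products of `n` elements of the associative algebra `S` vanish. -/
def PowVanishes (S : NonUnitalSubalgebra k B) (n : ℕ) : Prop :=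
  ∀ f : Fin n → B, (∀ i, f i ∈ S) → (List.ofFn f).prod = 0

/-- The associative algebra `S` is nilpotent. -/
def Nilpotent (S : NonUnitalSubalgebra k B) : Prop := ∃ n, 1 ≤ n ∧ PowVanishes S n

/-- The associative algebra `S` is nilpotent of index exactly `n`: `n` is the least positive
integer with `S ^ n = 0`. -/
def NilpotentOfIndex (S : NonUnitalSubalgebra k B) (n : ℕ) : Prop :=
  IsLeast {d | 1 ≤ d ∧ PowVanishes S d} n

end Nilpotence

end TernaryAlg

/-!
The identity `w₅ = 0` rewrites `(a b (c d e))` as `-((a b c) d e) - (a (b c d) e)`.  Rewriting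
`(a b (c d (e f g)))` from the inside and from the outside and comparing gives, in degree seven,

* `(a b (c d (e f g))) = ((a b c) (d e f) g)` (`comb_eq`),
* `((a b (c d e)) f g) = (a ((b c d) e f) g)` (`shift_eq`),

and their mirror images, since the identity is invariant under reversing the product.  Four
consequences of these in degree nine (`mul_nine_eq_zero`) relate
`u = ((a b c) (d e f) (g h i))` to three other monomials, and eliminating those leaves `3 u = 0`.
By `comb_eq` the monomial `u` is also the left comb `(a b (c d (e f (g h i))))`, so any four left
multiplications have product zero; `L(A) ^ 4 = 0` follows because a product of elements of a
generated algebra expands into words in the generators (`powVanishes_adjoin`), and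
`R(A) ^ 4 = 0` by reversing the product.

For sharpness, take the quotient `combAlg` of the graded free algebra on one generator with basis
in degrees `1, 3, 5, 5, 7`; there the left comb and the right comb of degree seven are both
nonzero.

For non-nilpotence, take the split null extension `cliffordAlg` of the one-dimensional algebra with
zero product by a bimodule.  When that algebra is spanned by `b`, the operators `l = l_{b,b}`,
`m = m_{b,b}`, `r = r_{b,b}` make a space into a bimodule exactly when `l² = r² = 0`, `m`
anticommutes with `l` and `r`, and `l r + r l + m² = 0`.  The Clifford algebra solution
`l = E₁₂`, `r = -E₂₁`, `m = diag(1, -1)` on `k²` has `l r = -E₁₁`, which is not nilpotent.  An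
algebra in the variety is a bimodule over itself (`Envelope.toEnd`), so that `U(A)` maps onto the
algebra generated by the left and right multiplications and is not nilpotent either.
-/

namespace TernaryAlg

universe u' v'

/-! ### Consequences of the identity in degrees seven and nine -/

section Identities

variable {k : Type u'} [Field k] {A : Type v'} [AddCommGroup A] [Module k A]
  {μ : A →ₗ[k] A →ₗ[k] A →ₗ[k] A}

theorem satisfiesW_five_iff :
    SatisfiesW μ 5 ↔
      ∀ a b c d e, μ (μ a b c) d e + μ a (μ b c d) e + μ a b (μ c d e) = 0 := by
  constructor
  · intro h a b c d e
    have := h fun n => [a, b, c, d, e].getD n 0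
    rw [w_five] at this
    simpa using this
  · intro h a
    rw [w_five]
    exact h ..

/-- The ternary algebra with the reversed product `(a, b, c) ↦ (c b a)`. -/
def reverse (μ : A →ₗ[k] A →ₗ[k] A →ₗ[k] A) : A →ₗ[k] A →ₗ[k] A →ₗ[k] A :=
  LinearMap.mk₂ k (fun a b => rightMul μ b a)
    (fun _ _ _ => by ext; simp [rightMul]) (fun _ _ _ => by ext; simp [rightMul])
    (fun _ _ _ => by ext; simp [rightMul]) (fun _ _ _ => by ext; simp [rightMul])

@[simp]
theorem reverse_apply (a b c : A) : reverse μ a b c = μ c b a := rfl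

theorem SatisfiesW.reverse (h : SatisfiesW μ 5) : SatisfiesW (reverse μ) 5 := by
  rw [satisfiesW_five_iff] at h ⊢
  intro a b c d e
  simp only [reverse_apply]
  rw [← h e d c b a]
  abel

theorem L_reverse : L (reverse μ) = R μ := by
  unfold L R
  congr 1
  ext f
  exact ⟨fun ⟨a, b, h⟩ => ⟨b, a, h⟩, fun ⟨a, b, h⟩ => ⟨b, a, h⟩⟩

variable [CharZero k]

/-- The left comb of degree seven, rewritten from the inside and from the outside, is
`((a b c) (d e f) g)` minus and plus the same sum of three monomials; so that sum is zero. -/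
theorem comb_add_eq_zero (h : SatisfiesW μ 5) (a b c d e f g : A) :
    μ a b (μ c d (μ e f g)) = μ (μ a b c) (μ d e f) g ∧
      μ (μ (μ a b c) d e) f g + μ (μ a (μ b c d) e) f g + μ a (μ (μ b c d) e f) g = 0 := by
  rw [satisfiesW_five_iff] at h
  have inner : μ a b (μ c d (μ e f g)) =
      μ (μ a b c) (μ d e f) g - (μ (μ (μ a b c) d e) f g + μ (μ a (μ b c d) e) f g
        + μ a (μ (μ b c d) e f) g) := by
    have h₁ := congrArg (μ a b) (h c d e f g)
    have h₂ := h a b (μ c d e) f g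
    have h₃ := h a b c (μ d e f) g
    have h₄ := congrArg (fun x => μ x f g) (h a b c d e)
    have h₅ := congrArg (fun x => μ a x g) (h b c d e f)
    simp only [map_add, map_zero, LinearMap.add_apply, LinearMap.zero_apply] at h₁ h₄ h₅
    linear_combination (norm := module) h₁ - h₂ - h₃ + h₄ + h₅
  have outer : μ a b (μ c d (μ e f g)) =
      μ (μ a b c) (μ d e f) g + (μ (μ (μ a b c) d e) f g + μ (μ a (μ b c d) e) f g
        + μ a (μ (μ b c d) e f) g) := by
    have h₁ := h a b c d (μ e f g)
    have h₂ := h (μ a b c) d e f g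
    have h₃ := h a (μ b c d) e f g
    linear_combination (norm := module) h₁ - h₂ - h₃
  constructor
  · linear_combination (norm := module) (2⁻¹ : k) • inner + (2⁻¹ : k) • outer
  · linear_combination (norm := module) (2⁻¹ : k) • inner - (2⁻¹ : k) • outer

theorem comb_eq (h : SatisfiesW μ 5) (a b c d e f g : A) :
    μ a b (μ c d (μ e f g)) = μ (μ a b c) (μ d e f) g :=
  (comb_add_eq_zero h a b c d e f g).1

theorem shift_eq (h : SatisfiesW μ 5) (a b c d e f g : A) :
    μ (μ a b (μ c d e)) f g = μ a (μ (μ b c d) e f) g := by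
  have h₁ := congrArg (fun x => μ x f g) (satisfiesW_five_iff.1 h a b c d e)
  simp only [map_add, map_zero, LinearMap.add_apply, LinearMap.zero_apply] at h₁
  linear_combination (norm := module) h₁ - (comb_add_eq_zero h a b c d e f g).2

theorem comb_eq' (h : SatisfiesW μ 5) (a b c d e f g : A) :
    μ (μ (μ a b c) d e) f g = μ a (μ b c d) (μ e f g) :=
  comb_eq h.reverse g f e d c b a

theorem shift_eq' (h : SatisfiesW μ 5) (a b c d e f g : A) :
    μ a b (μ (μ c d e) f g) = μ a (μ b c (μ d e f)) g :=
  shift_eq h.reverse g f e d c b a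

/-- The identity for `(c d e), f, g, p, q`, multiplied on the left by `a` and `b`, with its three
terms rewritten. -/
theorem add_add_eq_zero (h : SatisfiesW μ 5) (a b c d e f g p q : A) :
    μ a (μ (μ b c d) e (μ f g p)) q + μ (μ a b c) (μ d e f) (μ g p q)
      + μ a (μ b (μ c d e) (μ f g p)) q = 0 := by
  have h₁ : μ a b (μ (μ c d e) f (μ g p q)) = μ a (μ (μ b c d) e (μ f g p)) q := by
    rw [← shift_eq h, comb_eq h]
  have h₂ : μ a b (μ (μ c d e) (μ f g p) q) = μ (μ a b c) (μ d e f) (μ g p q) := by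
    rw [← comb_eq h, ← comb_eq h]
  have h₃ := congrArg (μ a b) (satisfiesW_five_iff.1 h (μ c d e) f g p q)
  simp only [map_add, map_zero] at h₃
  rw [h₁, h₂, shift_eq' h] at h₃
  rw [← h₃]
  abel

theorem mul_nine_eq_zero (h : SatisfiesW μ 5) (a b c d e f g p q : A) :
    μ (μ a b c) (μ d e f) (μ g p q) = 0 := by
  have h₁ := add_add_eq_zero h a b c d e f g p q
  have h₂ : μ a (μ (μ b c d) e (μ f g p)) q + μ (μ a b c) (μ d e f) (μ g p q)
      + μ a (μ (μ b c d) (μ e f g) p) q = 0 :=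
    add_add_eq_zero h.reverse q p g f e d c b a
  have h₃ := congrArg (fun x => μ a x q) (satisfiesW_five_iff.1 h b c d e (μ f g p))
  simp only [map_add, map_zero, LinearMap.add_apply, LinearMap.zero_apply] at h₃
  rw [comb_eq h] at h₃
  have h₄ := satisfiesW_five_iff.1 h a b c (μ d e f) (μ g p q)
  rw [← comb_eq' h a, ← comb_eq h a b c d e f g, shift_eq h, ← comb_eq' h c, shift_eq' h] at h₄
  -- `h₃` and `h₄` identify the first two monomials of `h₁` and `h₂`; what is left is `3 u = 0`.
  linear_combination (norm := module) (3⁻¹ : k) • h₁ + (3⁻¹ : k) • h₂ - (2/3 : k) • h₃ + (1/3 : k) • h₄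

end Identities

/-! ### Nilpotency of a generated subalgebra -/

section Powers

variable {k : Type u'} [Field k] {B : Type v'} [Ring B] [Algebra k B]

/-- The factor `p` is what makes the induction on the number of factors work: it collects the
generators that have already been chosen. -/
theorem mul_list_prod_eq_zero {s : Set B} (n : ℕ) :
    ∀ p : B, (∀ l : List B, l.length = n → (∀ x ∈ l, x ∈ s) → p * l.prod = 0) →
      ∀ l : List B, l.length = n → (∀ x ∈ l, x ∈ NonUnitalAlgebra.adjoin k s) →
        p * l.prod = 0 := by
  induction n with
  | zero =>
    intro p hp l hl _
    exact hp l hl (by simp [List.length_eq_zero_iff.1 hl])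
  | succ n ih =>
    intro p hp l hl hls
    obtain ⟨y, t, rfl⟩ := List.exists_cons_of_length_eq_add_one hl
    simp only [List.length_cons, Nat.add_right_cancel_iff] at hl
    simp only [List.mem_cons, forall_eq_or_imp] at hls
    obtain ⟨hy, ht⟩ := hls
    rw [List.prod_cons]
    induction hy using NonUnitalAlgebra.adjoin_induction generalizing t with
    | mem g hg =>
      rw [← mul_assoc]
      refine ih (p * g) (fun l' hl' hs' => ?_) t hl ht
      have := hp (g :: l') (by simp [hl']) (by simpa [hg] using hs')
      rwa [List.prod_cons, ← mul_assoc] at this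
    | add y z _ _ hy hz => rw [add_mul, mul_add, hy t hl ht, hz t hl ht, add_zero]
    | zero => simp
    | smul c y _ hy => rw [smul_mul_assoc, mul_smul_comm, hy t hl ht, smul_zero]
    | mul y z hym hzm hy hz =>
      -- The factor `z` is absorbed by the next one, if there is one.
      cases t with
      | nil =>
        have := hy [] hl ht
        simp only [List.prod_nil, mul_one] at this ⊢
        rw [← mul_assoc, this, zero_mul]
      | cons x t =>
        simp only [List.mem_cons, forall_eq_or_imp] at ht
        have := hy (z * x :: t) hl (by
          simpa only [List.mem_cons, forall_eq_or_imp] using ⟨mul_mem hzm ht.1, ht.2⟩)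
        simpa only [List.prod_cons, mul_assoc] using this

theorem powVanishes_adjoin {s : Set B} {n : ℕ}
    (h : ∀ l : List B, l.length = n → (∀ x ∈ l, x ∈ s) → l.prod = 0) :
    PowVanishes (NonUnitalAlgebra.adjoin k s) n := by
  intro f hf
  simpa using mul_list_prod_eq_zero (k := k) n 1 (by simpa using h) (List.ofFn f) (by simp)
    (by simpa [List.mem_ofFn] using hf)

theorem PowVanishes.pow_eq_zero {S : NonUnitalSubalgebra k B} {n : ℕ} (h : PowVanishes S n)
    {x : B} (hx : x ∈ S) : x ^ n = 0 := by
  simpa using h (fun _ => x) fun _ => hx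

theorem nilpotentOfIndex_four {S : NonUnitalSubalgebra k B} (h : PowVanishes S 4) {x : B}
    (hx : x ∈ S) (hx₃ : x ^ 3 ≠ 0) : NilpotentOfIndex S 4 := by
  refine ⟨⟨by norm_num, h⟩, fun d hd => ?_⟩
  by_contra! hlt
  exact hx₃ (pow_eq_zero_of_le (by omega) (hd.2.pow_eq_zero hx))

theorem not_nilpotent {S : NonUnitalSubalgebra k B} {x : B} (hx : x ∈ S)
    (h : ¬ IsNilpotent x) : ¬ Nilpotent S :=
  fun ⟨n, _, hn⟩ => h ⟨n, hn.pow_eq_zero hx⟩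

end Powers

/-! ### Multiplication algebras and the universal envelope -/

section LeftRight

variable {k : Type u'} [Field k] {A : Type v'} [AddCommGroup A] [Module k A]
  {μ : A →ₗ[k] A →ₗ[k] A →ₗ[k] A}

theorem leftMul_mem_L (a b : A) : leftMul μ a b ∈ L μ :=
  NonUnitalAlgebra.subset_adjoin k ⟨a, b, rfl⟩

theorem rightMul_mem_R (a b : A) : rightMul μ a b ∈ R μ :=
  NonUnitalAlgebra.subset_adjoin k ⟨a, b, rfl⟩

theorem leftMul_mem_LR (a b : A) : leftMul μ a b ∈ LR μ :=
  NonUnitalAlgebra.subset_adjoin k (Or.inl ⟨a, b, rfl⟩)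

theorem rightMul_mem_LR (a b : A) : rightMul μ a b ∈ LR μ :=
  NonUnitalAlgebra.subset_adjoin k (Or.inr ⟨a, b, rfl⟩)

theorem of_l_mem_U (a b : A) : Envelope.of μ (.l a b) ∈ U μ :=
  NonUnitalAlgebra.subset_adjoin k (Or.inl ⟨a, b, rfl⟩)

theorem of_r_mem_U (a b : A) : Envelope.of μ (.r a b) ∈ U μ :=
  NonUnitalAlgebra.subset_adjoin k (Or.inr ⟨a, b, rfl⟩)

theorem powVanishes_L_four [CharZero k] (h : SatisfiesW μ 5) : PowVanishes (L μ) 4 := by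
  refine powVanishes_adjoin fun l hl hs => ?_
  match l, hl with
  | [x₁, x₂, x₃, x₄], _ =>
    simp only [List.mem_cons, List.not_mem_nil, or_false, forall_eq_or_imp, forall_eq] at hs
    obtain ⟨⟨a, b, rfl⟩, ⟨c, d, rfl⟩, ⟨e, f, rfl⟩, ⟨g, p, rfl⟩⟩ := hs
    ext q
    simp only [List.prod_cons, List.prod_nil, mul_one, Module.End.mul_apply, leftMul,
      LinearMap.zero_apply]
    rw [comb_eq h, mul_nine_eq_zero h]

theorem powVanishes_R_four [CharZero k] (h : SatisfiesW μ 5) : PowVanishes (R μ) 4 :=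
  L_reverse (μ := μ) ▸ powVanishes_L_four h.reverse

/-- The middle multiplication `x ↦ (a x b)`. -/
def midMul (μ : A →ₗ[k] A →ₗ[k] A →ₗ[k] A) (a b : A) : Module.End k A := (μ a).flip b

/-- The operator on `A` by which a symbol acts on the regular bimodule. -/
def MulSym.toEnd (μ : A →ₗ[k] A →ₗ[k] A →ₗ[k] A) : MulSym A → Module.End k A
  | .l a b => leftMul μ a b
  | .m a b => midMul μ a b
  | .r a b => rightMul μ a b

/-- The action of the universal multiplicative envelope on the regular bimodule `A`. -/
def Envelope.toEnd (h : SatisfiesW μ 5) : Envelope μ →ₐ[k] Module.End k A :=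
  RingQuot.liftAlgHom k ⟨FreeAlgebra.lift k (MulSym.toEnd μ), by
    have h' := satisfiesW_five_iff.1 h
    intro x y hxy
    induction hxy <;> ext z <;>
      simp [MulSym.toEnd, leftMul, midMul, rightMul]
    case w5_1 b c d e => exact h' z b c d e
    case w5_2 a c d e => exact h' a z c d e
    case w5_3 a b d e => exact h' a b z d e
    case w5_4 a b c e => exact h' a b c z e
    case w5_5 a b c d => rw [← h' a b c d z]⟩

@[simp]
theorem Envelope.toEnd_of (h : SatisfiesW μ 5) (s : MulSym A) :
    Envelope.toEnd h (Envelope.of μ s) = s.toEnd μ := by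
  simp [Envelope.toEnd, Envelope.of]

end LeftRight

/-! ### Sharpness and failure of nilpotence -/

section Examples

variable (k : Type u') [Field k]

set_option maxHeartbeats 1000000 in
/-- The graded algebra with basis `e₀, e₁, e₂, e₃, e₄` in degrees `1, 3, 5, 5, 7`, where
`e₁ = (e₀ e₀ e₀)`, `e₂ = (e₁ e₀ e₀)`, `e₃ = (e₀ e₀ e₁)`, and `(e₀ e₁ e₀) = -e₂ - e₃` as `w₅ = 0`
requires.  The products in degree seven are a solution of the five instances of `w₅ = 0` of this
degree with `(e₂ e₀ e₀)` and `(e₀ e₀ e₃)` nonzero. -/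
def combAlg : (Fin 5 → k) →ₗ[k] (Fin 5 → k) →ₗ[k] (Fin 5 → k) →ₗ[k] (Fin 5 → k) :=
  LinearMap.mk₂ k
    (fun x y =>
      { toFun z := ![0, x 0 * y 0 * z 0, x 1 * y 0 * z 0 - x 0 * y 1 * z 0,
          x 0 * y 0 * z 1 - x 0 * y 1 * z 0,
          x 2 * y 0 * z 0 - x 0 * y 0 * z 3 - x 1 * y 1 * z 0 + x 0 * y 1 * z 1]
        map_add' z z' := by ext i; fin_cases i <;> simp <;> ring
        map_smul' c z := by ext i; fin_cases i <;> simp <;> ring })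
    (fun x x' y => by ext z i; fin_cases i <;> simp <;> ring)
    (fun c x y => by ext z i; fin_cases i <;> simp <;> ring)
    (fun x y y' => by ext z i; fin_cases i <;> simp <;> ring)
    (fun c x y => by ext z i; fin_cases i <;> simp <;> ring)

theorem combAlg_apply (x y z : Fin 5 → k) : combAlg k x y z =
    ![0, x 0 * y 0 * z 0, x 1 * y 0 * z 0 - x 0 * y 1 * z 0, x 0 * y 0 * z 1 - x 0 * y 1 * z 0,
      x 2 * y 0 * z 0 - x 0 * y 0 * z 3 - x 1 * y 1 * z 0 + x 0 * y 1 * z 1] := rfl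

theorem satisfiesW_combAlg : SatisfiesW (combAlg k) 5 := by
  rw [satisfiesW_five_iff]
  intro a b c d e
  ext i
  fin_cases i <;> simp [combAlg_apply] <;> ring

theorem leftMul_combAlg_pow_ne_zero :
    leftMul (combAlg k) (Pi.single 0 1) (Pi.single 0 1) ^ 3 ≠ 0 := by
  intro h
  have := congrFun (LinearMap.congr_fun h (Pi.single 0 1)) 4
  simp [pow_succ, leftMul, combAlg_apply] at this

theorem rightMul_combAlg_pow_ne_zero :
    rightMul (combAlg k) (Pi.single 0 1) (Pi.single 0 1) ^ 3 ≠ 0 := by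
  intro h
  have := congrFun (LinearMap.congr_fun h (Pi.single 0 1)) 4
  simp [pow_succ, rightMul, combAlg_apply] at this

/-- The split null extension of the algebra `k b` with zero product by the bimodule `k²` on which
`l_{b,b} = E₁₂`, `m_{b,b} = diag(1, -1)` and `r_{b,b} = -E₂₁`.  The coordinate `0` is that of `b`,
the coordinates `1` and `2` are those of `k²`. -/
def cliffordAlg : (Fin 3 → k) →ₗ[k] (Fin 3 → k) →ₗ[k] (Fin 3 → k) →ₗ[k] (Fin 3 → k) :=
  LinearMap.mk₂ k
    (fun x y =>
      { toFun z := ![0, x 0 * y 0 * z 2 + x 0 * y 1 * z 0, - x 1 * y 0 * z 0 - x 0 * y 2 * z 0]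
        map_add' z z' := by ext i; fin_cases i <;> simp <;> ring
        map_smul' c z := by ext i; fin_cases i <;> simp <;> ring })
    (fun x x' y => by ext z i; fin_cases i <;> simp <;> ring)
    (fun c x y => by ext z i; fin_cases i <;> simp <;> ring)
    (fun x y y' => by ext z i; fin_cases i <;> simp <;> ring)
    (fun c x y => by ext z i; fin_cases i <;> simp <;> ring)

theorem cliffordAlg_apply (x y z : Fin 3 → k) : cliffordAlg k x y z =
    ![0, x 0 * y 0 * z 2 + x 0 * y 1 * z 0, - x 1 * y 0 * z 0 - x 0 * y 2 * z 0] := rfl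

theorem satisfiesW_cliffordAlg : SatisfiesW (cliffordAlg k) 5 := by
  rw [satisfiesW_five_iff]
  intro a b c d e
  ext i
  fin_cases i <;> simp [cliffordAlg_apply] <;> ring

/-- On `k b ⊕ k²` the operator `l_{b,b} r_{b,b}` has the eigenvalue `-1`. -/
theorem not_isNilpotent_leftMul_mul_rightMul :
    ¬ IsNilpotent (leftMul (cliffordAlg k) (Pi.single 0 1) (Pi.single 0 1) *
      rightMul (cliffordAlg k) (Pi.single 0 1) (Pi.single 0 1)) := by
  rintro ⟨n, hn⟩
  set f := leftMul (cliffordAlg k) (Pi.single 0 1) (Pi.single 0 1) *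
    rightMul (cliffordAlg k) (Pi.single 0 1) (Pi.single 0 1) with hf
  have h₁ : f (Pi.single 1 1) = (-1 : k) • Pi.single 1 1 := by
    ext i
    fin_cases i <;> simp [hf, leftMul, rightMul, cliffordAlg_apply]
  have h₂ : (f ^ n) (Pi.single 1 1) = (-1 : k) ^ n • Pi.single 1 1 := by
    clear hn
    induction n with
    | zero => simp
    | succ n ih => rw [pow_succ, Module.End.mul_apply, h₁, map_smul, ih, smul_smul, pow_succ']
  rw [hn] at h₂
  have := congrFun h₂ 1
  exact pow_ne_zero n (neg_ne_zero.2 (one_ne_zero (α := k))) (by simpa using this.symm)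

end Examples

end TernaryAlg

theorem mainTheorem2 {k : Type u} [Field k] [CharZero k] :
    (∀ (A : Type v) [AddCommGroup A] [Module k A] (μ : A →ₗ[k] A →ₗ[k] A →ₗ[k] A),
      TernaryAlg.SatisfiesW μ 5 →
        TernaryAlg.PowVanishes (TernaryAlg.L μ) 4 ∧ TernaryAlg.PowVanishes (TernaryAlg.R μ) 4) ∧
    (∃ (A : Type u) (_ : AddCommGroup A) (_ : Module k A) (μ : A →ₗ[k] A →ₗ[k] A →ₗ[k] A),
      TernaryAlg.SatisfiesW μ 5 ∧
        TernaryAlg.NilpotentOfIndex (TernaryAlg.L μ) 4 ∧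
        TernaryAlg.NilpotentOfIndex (TernaryAlg.R μ) 4) ∧
    (∃ (A : Type u) (_ : AddCommGroup A) (_ : Module k A) (μ : A →ₗ[k] A →ₗ[k] A →ₗ[k] A),
      TernaryAlg.SatisfiesW μ 5 ∧
        ¬ TernaryAlg.Nilpotent (TernaryAlg.U μ) ∧
        ¬ TernaryAlg.Nilpotent (TernaryAlg.LR μ)) := by
  refine ⟨fun A _ _ μ h => ⟨TernaryAlg.powVanishes_L_four h, TernaryAlg.powVanishes_R_four h⟩,
    ⟨Fin 5 → k, inferInstance, inferInstance, TernaryAlg.combAlg k,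
      TernaryAlg.satisfiesW_combAlg k, ?_, ?_⟩,
    ⟨Fin 3 → k, inferInstance, inferInstance, TernaryAlg.cliffordAlg k,
      TernaryAlg.satisfiesW_cliffordAlg k, ?_, ?_⟩⟩
  · exact TernaryAlg.nilpotentOfIndex_four
      (TernaryAlg.powVanishes_L_four (TernaryAlg.satisfiesW_combAlg k))
      (TernaryAlg.leftMul_mem_L _ _) (TernaryAlg.leftMul_combAlg_pow_ne_zero k)
  · exact TernaryAlg.nilpotentOfIndex_four
      (TernaryAlg.powVanishes_R_four (TernaryAlg.satisfiesW_combAlg k))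
      (TernaryAlg.rightMul_mem_R _ _) (TernaryAlg.rightMul_combAlg_pow_ne_zero k)
  · refine TernaryAlg.not_nilpotent
      (mul_mem (TernaryAlg.of_l_mem_U (Pi.single 0 1) (Pi.single 0 1))
        (TernaryAlg.of_r_mem_U (Pi.single 0 1) (Pi.single 0 1))) fun h => ?_
    have := h.map (TernaryAlg.Envelope.toEnd (TernaryAlg.satisfiesW_cliffordAlg k))
    rw [map_mul, TernaryAlg.Envelope.toEnd_of, TernaryAlg.Envelope.toEnd_of] at this
    exact TernaryAlg.not_isNilpotent_leftMul_mul_rightMul k this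
  · exact TernaryAlg.not_nilpotent
      (mul_mem (TernaryAlg.leftMul_mem_LR _ _) (TernaryAlg.rightMul_mem_LR _ _))
      (TernaryAlg.not_isNilpotent_leftMul_mul_rightMul k)
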